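/- Let $\varphi:\mathbb R\to\mathbb R$ be an Orlicz $N$-function (continuous, even, convex, $\varphi(0)=0$, $\varphi(x)>0$ for $x\ne0$, $\varphi(x)/x\to0$ as $x\to0$, $\varphi(x)/x\to\infty$ as $x\to\infty$) satisfying condition $Q$: $\liminf_{x\to0}\varphi(x)/x^2>0$ (the value $\infty$ is allowed). Let $\varphi^*(x)=\sup_{y\in\mathbb R}(xy-\varphi(y))$. A random variable $\zeta$ is called $\varphi$-sub-Gaussian if $\mathsf E\zeta=0$, $\mathsf E e^{\lambda\zeta}<\infty$ for all $\lambda\in\mathbb R$, and there is $a>0$ with $\mathsf E e^{\lambda\zeta}\le e^{\varphi(\lambda a)}$ for all $\lambda\in\mathbb R$; put $\tau_\varphi(\zeta)=\inf\{a>0:\mathsf E e^{\lambda\zeta}\le e^{\varphi(a\lambda)}\ \text{for all }\lambda\in\mathbb R\}$. Let $\mathbf T=[a_1,b_1]\times[a_2,b_2]$ with $a_i\le b_i$ and $\varkappa:=\max_{i=1,2}(b_i-a_i)>0$, and let $d(t,s)=\max_{i=1,2}|t_i-s_i|$. Let $X=\{X(t),t\in\mathbf T\}$ be a process of $\varphi$-sub-Gaussian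 random variables that is separable with respect to $\rho_X(t,s)=\tau_\varphi(X(t)-X(s))$, i.e. there is a countable $S\subseteq\mathbf T$ such that almost surely, for all $t\in\mathbf T$ and $\varepsilon>0$, some $s\in S$ satisfies $\rho_X(t,s)<\varepsilon$ and $|X(t)-X(s)|<\varepsilon$ (under the assumptions below this holds in particular if $X$ is separable with respect to $d$). Suppose $0<\varepsilon_0:=\sup_{t\in\mathbf T}\tau_\varphi(X(t))<\infty$ and $$\sup_{t,s\in\mathbf T,\ d(t,s)\le h}\tau_\varphi(X(t)-X(s))\le\sigma(h),\qquad 0<h\le\varkappa,$$ where $\sigma$ is a strictly increasing continuous function on $(0,\varkappa]$ with $\sigma(h)\to0$ as $h\to0$. Put $\gamma_0=\sigma(\varkappa)$. Let $r:[1,\infty)\to[0,\infty)$ be strictly increasing and such that $x\mapsto r(e^x)$ is convex on $[0,\infty)$, and suppose that for $0<\varepsilon\le\gamma_0$ $$\tilde I_r(\varepsilon):=\int_0^\varepsilon r\left(\Big(\frac{b_1-a_1}{2\sigma^{(-1)}(v)}+1\Big)\Big(\frac{b_2-a_2}{2\sigma^{(-1)}(v)}+1\Big)\right)dv<\infty,$$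 where $\sigma^{(-1)}$ denotes the inverse function of $\sigma$. Then for all $0<\theta<1$ and $u>0$ such that $r(1)=0$ or $\theta\varepsilon_0\le\gamma_0$ (in particular, for all $0<\theta<1$ and $u>0$ if $r(1)=0$), $$\mathsf P\Big\{\sup_{t\in\mathbf T}|X(t)|\ge u\Big\}\le 2\exp\Big\{-\varphi^*\Big(\frac{u(1-\theta)}{\varepsilon_0}\Big)\Big\}\,r^{(-1)}\left(\frac{\tilde I_r(\min(\theta\varepsilon_0,\gamma_0))}{\theta\varepsilon_0}\right),$$ where $r^{(-1)}$ denotes the inverse function of $r$. -/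

import Mathlib

open MeasureTheory Filter Set
open scoped Topology

noncomputable section

/-- Orlicz N-functions. -/
structure IsOrliczNFunction (φ : ℝ → ℝ) : Prop where
  continuous : Continuous φ
  even : ∀ x, φ (-x) = φ x
  convex : ConvexOn ℝ univ φ
  zero : φ 0 = 0
  pos : ∀ x, x ≠ 0 → 0 < φ x
  tendsto_zero : Tendsto (fun x => φ x / x) (𝓝[≠] 0) (𝓝 0)
  tendsto_atTop : Tendsto (fun x => φ x / x) atTop atTop

/-- Condition Q: `φ` is an N-function with `liminf_{x → 0} φ(x) / x² > 0`, where the value `∞` of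
the lower limit is allowed. -/
structure ConditionQ (φ : ℝ → ℝ) : Prop extends IsOrliczNFunction φ where
  liminf_pos : 0 < liminf (fun x : ℝ => ENNReal.ofReal (φ x / x ^ 2)) (𝓝[≠] 0)

/-- The Young–Fenchel transform `φ*(x) = sup_y (x y - φ(y))`; the supremum is finite for
N-functions. -/
def youngFenchel (φ : ℝ → ℝ) (x : ℝ) : ℝ := ⨆ y : ℝ, (x * y - φ y)

/-- `φ`-sub-Gaussian random variables. -/
structure IsPhiSubGaussian {Ω : Type*} [MeasurableSpace Ω] (μ : Measure Ω) (φ : ℝ → ℝ)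
    (ζ : Ω → ℝ) : Prop where
  integrable : Integrable ζ μ
  mean_zero : ∫ ω, ζ ω ∂μ = 0
  integrable_exp : ∀ l : ℝ, Integrable (fun ω => Real.exp (l * ζ ω)) μ
  exists_bound : ∃ a : ℝ, 0 < a ∧
    ∀ l : ℝ, ∫ ω, Real.exp (l * ζ ω) ∂μ ≤ Real.exp (φ (l * a))

/-- The `φ`-sub-Gaussian standard `τ_φ(ζ)`. -/
def phiStandard {Ω : Type*} [MeasurableSpace Ω] (μ : Measure Ω) (φ : ℝ → ℝ) (ζ : Ω → ℝ) : ℝ :=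
  sInf {a : ℝ | 0 < a ∧ ∀ l : ℝ, ∫ ω, Real.exp (l * ζ ω) ∂μ ≤ Real.exp (φ (a * l))}

/-- The pseudometric `ρ_X(t, s) = τ_φ(X(t) - X(s))` generated by the process `X`. -/
def phiPseudometric {Ω T : Type*} [MeasurableSpace Ω] (μ : Measure Ω) (φ : ℝ → ℝ)
    (X : T → Ω → ℝ) (t s : T) : ℝ :=
  phiStandard μ φ (fun ω => X t ω - X s ω)

/-- Separability of a process with respect to a pseudometric `ρ` on the parameter set: there is a
countable `S ⊆ T` such that, almost surely, for every `t` the point `(t, X(t))` is in the closure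
of `{(s, X(s)) : s ∈ S}`. -/
def IsSeparableProcess {Ω T : Type*} [MeasurableSpace Ω] (μ : Measure Ω) (ρ : T → T → ℝ)
    (X : T → Ω → ℝ) : Prop :=
  ∃ S : Set T, S.Countable ∧
    ∀ᵐ ω ∂μ, ∀ t : T, ∀ ε > 0, ∃ s ∈ S, ρ t s < ε ∧ |X t ω - X s ω| < ε

/-- The rectangle `[a₁, b₁] × [a₂, b₂]`. The distance of `ℝ × ℝ` in Mathlib is the max-metric. -/
abbrev Rect (a₁ b₁ a₂ b₂ : ℝ) : Set (ℝ × ℝ) := Icc a₁ b₁ ×ˢ Icc a₂ b₂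

/-- The integrand
`r (((b₁ - a₁) / (2 σ⁻¹(v)) + 1) ((b₂ - a₂) / (2 σ⁻¹(v)) + 1))`,
where `σ⁻¹` is the inverse of `σ` on `(0, max (b₁ - a₁) (b₂ - a₂)]`. -/
def entropyIntegrand (r σ : ℝ → ℝ) (a₁ b₁ a₂ b₂ v : ℝ) : ℝ :=
  r (((b₁ - a₁) / (2 * Function.invFunOn σ (Ioc 0 (max (b₁ - a₁) (b₂ - a₂))) v) + 1) *
    ((b₂ - a₂) / (2 * Function.invFunOn σ (Ioc 0 (max (b₁ - a₁) (b₂ - a₂))) v) + 1))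

/-- The entropy integral over `(0, ε]`. -/
def entropyIntegral (r σ : ℝ → ℝ) (a₁ b₁ a₂ b₂ ε : ℝ) : ℝ :=
  ∫ v in Ioc 0 ε, entropyIntegrand r σ a₁ b₁ a₂ b₂ v

end

/-! The proof is a chaining argument with geometric weights. Put δ = θε₀ and take nets `U k` of
ρ_X-radius θ^k δ. Telescoping along nearest net points writes X(t) as a sum of terms Z_k, where Z_k
has standard at most θ^k ε₀. With weights w_k = (1 - θ)θ^k, the rescaled terms l Z_k / w_k all
satisfy the same exponential bound exp(φ(lε₀/(1 - θ))). Convexity of exp and Markov's inequality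
(`measureReal_le_exp_of_chain`) then bound the tail by exp(-lu) · 2 exp(φ(lε₀/(1 - θ))) times the
weighted geometric mean of the cardinalities.

Jensen's inequality for r ∘ exp (`sum_mul_log_le_log_invFunOn`) bounds this mean by r⁻¹ of the
weighted average of r(card `U k`). That average is a lower Riemann sum of the entropy integral
divided by δ (`sum_geometric_mul_le_integral`). Finite parameter sets are handled first,
separability gives the whole rectangle, and varying l produces φ*. -/

/-! ### φ-sub-Gaussian variables -/

lemma IsOrliczNFunction.le_of_abs_le {φ : ℝ → ℝ} (hφ : IsOrliczNFunction φ) {x y : ℝ}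
    (h : |x| ≤ |y|) : φ x ≤ φ y := by
  have hy : φ |y| = φ y := by
    rcases abs_choice y with h | h <;> rw [h]
    exact hφ.even y
  have hmem : x ∈ segment ℝ (-|y|) |y| := by
    rw [segment_eq_Icc (by linarith [abs_nonneg y])]
    exact abs_le.1 h
  have := hφ.convex.le_max_of_mem_segment (mem_univ _) (mem_univ _) hmem
  rwa [hφ.even, max_self, hy] at this

section PhiSubGaussian

variable {Ω : Type*} [MeasurableSpace Ω] {μ : Measure Ω} {φ : ℝ → ℝ} {ζ η : Ω → ℝ}

/-- AM-GM separates the two variables without independence, at the cost of doubling the parameter.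
-/
lemma exp_mul_sub_le_add (l x y : ℝ) :
    Real.exp (l * (x - y)) ≤ (Real.exp (2 * l * x) + Real.exp (-2 * l * y)) / 2 := by
  have h := sq_nonneg (Real.exp (l * x) - Real.exp (-l * y))
  have h1 : Real.exp (2 * l * x) = Real.exp (l * x) ^ 2 := by rw [← Real.exp_nat_mul]; ring_nf
  have h2 : Real.exp (-2 * l * y) = Real.exp (-l * y) ^ 2 := by rw [← Real.exp_nat_mul]; ring_nf
  have h3 : Real.exp (l * (x - y)) = Real.exp (l * x) * Real.exp (-l * y) := by
    rw [← Real.exp_add]; ring_nf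
  rw [h1, h2, h3]
  linarith

lemma IsPhiSubGaussian.sub (hφ : IsOrliczNFunction φ) (hζ : IsPhiSubGaussian μ φ ζ)
    (hη : IsPhiSubGaussian μ φ η) : IsPhiSubGaussian μ φ (fun ω => ζ ω - η ω) := by
  have hdom (l : ℝ) : Integrable
      (fun ω => (Real.exp (2 * l * ζ ω) + Real.exp (-2 * l * η ω)) / 2) μ :=
    ((hζ.integrable_exp _).add (hη.integrable_exp _)).div_const 2
  have hexp (l : ℝ) : Integrable (fun ω => Real.exp (l * (ζ ω - η ω))) μ := by
    refine (hdom l).mono' ?_ (ae_of_all _ fun ω => ?_)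
    · exact Real.continuous_exp.comp_aestronglyMeasurable
        ((hζ.integrable.sub hη.integrable).aestronglyMeasurable.const_mul l)
    · rw [Real.norm_eq_abs, Real.abs_exp]
      exact exp_mul_sub_le_add _ _ _
  refine ⟨hζ.integrable.sub hη.integrable, ?_, hexp, ?_⟩
  · rw [integral_sub hζ.integrable hη.integrable, hζ.mean_zero, hη.mean_zero, sub_zero]
  · obtain ⟨a, ha, hζa⟩ := hζ.exists_bound
    obtain ⟨b, hb, hηb⟩ := hη.exists_bound
    refine ⟨2 * max a b, by positivity, fun l => ?_⟩
    have hm : 0 < max a b := lt_max_of_lt_left ha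
    have h1 : φ (2 * l * a) ≤ φ (l * (2 * max a b)) := by
      apply hφ.le_of_abs_le
      simp only [abs_mul, abs_of_pos ha, abs_of_pos hm, abs_two]
      nlinarith [abs_nonneg l, le_max_left a b]
    have h2 : φ (-2 * l * b) ≤ φ (l * (2 * max a b)) := by
      apply hφ.le_of_abs_le
      simp only [abs_mul, abs_of_pos hb, abs_of_pos hm, abs_neg, abs_two]
      nlinarith [abs_nonneg l, le_max_right a b]
    have h3 := (integral_mono (hexp l) (hdom l) fun ω => exp_mul_sub_le_add l (ζ ω) (η ω))
    rw [integral_div, integral_add (hζ.integrable_exp _) (hη.integrable_exp _)] at h3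
    have h4 := (hζa (2 * l)).trans (Real.exp_le_exp.2 h1)
    have h5 := (hηb (-2 * l)).trans (Real.exp_le_exp.2 h2)
    linarith

/-- Every c' > c exceeds an admissible constant, and φ grows with the absolute value of its
argument; continuity of φ lets c' decrease to c. -/
lemma IsPhiSubGaussian.integral_exp_le (hφ : IsOrliczNFunction φ) (hζ : IsPhiSubGaussian μ φ ζ)
    {c : ℝ} (hc : phiStandard μ φ ζ ≤ c) (l : ℝ) :
    ∫ ω, Real.exp (l * ζ ω) ∂μ ≤ Real.exp (φ (c * l)) := by
  have hlim : Tendsto (fun c' => Real.exp (φ (c' * l))) (𝓝[>] c) (𝓝 (Real.exp (φ (c * l)))) := by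
    have : Continuous fun c' => Real.exp (φ (c' * l)) :=
      Real.continuous_exp.comp (hφ.continuous.comp (continuous_id.mul continuous_const))
    exact (this.tendsto c).mono_left nhdsWithin_le_nhds
  refine ge_of_tendsto hlim ?_
  filter_upwards [self_mem_nhdsWithin] with c' hc'
  obtain ⟨a, ha, hζa⟩ := hζ.exists_bound
  obtain ⟨b, hb, hbc⟩ := exists_lt_of_csInf_lt
    (⟨a, ha, fun l => by rw [mul_comm]; exact hζa l⟩ :
      {a : ℝ | 0 < a ∧ ∀ l : ℝ, ∫ ω, Real.exp (l * ζ ω) ∂μ ≤ Real.exp (φ (a * l))}.Nonempty)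
    (lt_of_le_of_lt hc hc')
  refine (hb.2 l).trans (Real.exp_le_exp.2 (hφ.le_of_abs_le ?_))
  rw [abs_mul, abs_mul]
  gcongr
  exact hb.1.le

end PhiSubGaussian

/-! ### Finite covers of the rectangle -/

lemma exists_finset_Icc_cover {a b h : ℝ} (hab : a ≤ b) (hh : 0 < h) :
    ∃ A : Finset ℝ, (∀ y ∈ A, y ∈ Icc a b) ∧ (A.card : ℝ) ≤ (b - a) / (2 * h) + 1 ∧
      ∀ x ∈ Icc a b, ∃ y ∈ A, |x - y| ≤ h := by
  classical
  set N : ℕ := ⌊(b - a) / (2 * h)⌋₊ with hN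
  have hq : 0 ≤ (b - a) / (2 * h) := div_nonneg (by linarith) (by linarith)
  have hlt : (b - a) / (2 * h) < N + 1 := Nat.lt_floor_add_one _
  have hlt' : b - a < (N + 1) * (2 * h) := (div_lt_iff₀ (by linarith)).1 hlt
  -- Midpoints of consecutive intervals of length 2h; the cap at b keeps the last one inside [a, b]
  -- and only moves it closer to the points it serves.
  refine ⟨(Finset.range (N + 1)).image fun i : ℕ => min (a + (2 * i + 1) * h) b, ?_, ?_, ?_⟩
  · intro y hy
    obtain ⟨i, -, rfl⟩ := Finset.mem_image.1 hy
    exact ⟨le_min (by nlinarith [(Nat.cast_nonneg i : (0 : ℝ) ≤ i)]) hab, min_le_right _ _⟩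
  · have h1 : (((Finset.range (N + 1)).image fun i : ℕ => min (a + (2 * i + 1) * h) b).card : ℝ)
        ≤ ((N + 1 : ℕ) : ℝ) := by
      exact_mod_cast Finset.card_image_le.trans (Finset.card_range _).le
    push_cast at h1
    linarith [Nat.floor_le hq]
  · intro x hx
    have hx0 : 0 ≤ (x - a) / (2 * h) := div_nonneg (by linarith [hx.1]) (by linarith)
    set i : ℕ := ⌊(x - a) / (2 * h)⌋₊ with hi
    have h1 : (i : ℝ) * (2 * h) ≤ x - a := (le_div_iff₀ (by linarith)).1 (Nat.floor_le hx0)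
    have h2 : x - a < (i + 1) * (2 * h) :=
      (div_lt_iff₀ (by linarith)).1 (Nat.lt_floor_add_one _)
    refine ⟨_, Finset.mem_image.2 ⟨i, Finset.mem_range.2 (Nat.lt_succ_of_le ?_), rfl⟩, ?_⟩
    · exact Nat.floor_le_floor (by gcongr; exact hx.2)
    · rcases min_choice (a + (2 * i + 1) * h) b with hm | hm <;> rw [hm]
      · rw [abs_le]; constructor <;> linarith
      · have := min_eq_right_iff.1 hm
        rw [abs_le]; constructor <;> linarith [hx.2]

lemma exists_finset_Rect_cover {a₁ b₁ a₂ b₂ h : ℝ} (h₁ : a₁ ≤ b₁) (h₂ : a₂ ≤ b₂) (hh : 0 < h) :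
    ∃ A : Finset (Rect a₁ b₁ a₂ b₂), A.Nonempty ∧
      (A.card : ℝ) ≤ ((b₁ - a₁) / (2 * h) + 1) * ((b₂ - a₂) / (2 * h) + 1) ∧
      ∀ t, ∃ s ∈ A, dist t s ≤ h := by
  classical
  obtain ⟨A, hA, hAc, hAd⟩ := exists_finset_Icc_cover h₁ hh
  obtain ⟨B, hB, hBc, hBd⟩ := exists_finset_Icc_cover h₂ hh
  have hcov : ∀ t : Rect a₁ b₁ a₂ b₂,
      ∃ s ∈ (A ×ˢ B).subtype (· ∈ Rect a₁ b₁ a₂ b₂), dist t s ≤ h := by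
    rintro ⟨⟨x, y⟩, hx, hy⟩
    obtain ⟨x', hx', hxx⟩ := hAd x hx
    obtain ⟨y', hy', hyy⟩ := hBd y hy
    refine ⟨⟨(x', y'), hA x' hx', hB y' hy'⟩, ?_, ?_⟩
    · simp [hx', hy']
    · exact max_le hxx hyy
  refine ⟨_, ?_, ?_, hcov⟩
  · obtain ⟨s, hs, -⟩ := hcov ⟨(a₁, a₂), left_mem_Icc.2 h₁, left_mem_Icc.2 h₂⟩
    exact ⟨s, hs⟩
  · have hc : (((A ×ˢ B).subtype (· ∈ Rect a₁ b₁ a₂ b₂)).card : ℝ) ≤ A.card * B.card := by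
      rw [Finset.card_subtype]
      exact_mod_cast (Finset.card_filter_le _ _).trans (Finset.card_product _ _).le
    refine hc.trans (mul_le_mul hAc hBc (Nat.cast_nonneg _) ((Nat.cast_nonneg _).trans hAc))

/-! ### Exponential Markov inequality and chains -/

/-- Exponential Markov inequality for sums of maxima over finite families. -/
lemma measureReal_le_exp_of_chain {Ω T ι : Type*} [MeasurableSpace Ω] {μ : Measure Ω}
    [IsFiniteMeasure μ] (I : Finset ι) (w M : ι → ℝ) (hw : ∀ i ∈ I, 0 < w i)
    (hw1 : ∑ i ∈ I, w i = 1) (hM : ∀ i ∈ I, 0 < M i) (U : ι → Finset T) (Z : ι → T → Ω → ℝ)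
    (l x : ℝ) (hl : 0 ≤ l)
    (hint : ∀ i ∈ I, ∀ t ∈ U i, ∀ c : ℝ, Integrable (fun ω => Real.exp (c * Z i t ω)) μ)
    (hbound : ∀ i ∈ I, ∑ t ∈ U i, (∫ ω, Real.exp (l / w i * Z i t ω) ∂μ +
      ∫ ω, Real.exp (-(l / w i) * Z i t ω) ∂μ) ≤ M i)
    (E : Set Ω) (hE : ∀ ω ∈ E, ∃ z : ι → T, (∀ i ∈ I, z i ∈ U i) ∧ x ≤ ∑ i ∈ I, |Z i (z i) ω|) :
    μ.real E ≤ Real.exp (-(l * x)) * Real.exp (∑ i ∈ I, w i * Real.log (M i)) := by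
  -- Summing over all points and both signs dominates exp(l|Z_i|/w_i) at any point of `U i`.
  -- Dividing by M_i makes W a weighted average with mean at most 1.
  set G : ι → Ω → ℝ := fun i ω => ∑ t ∈ U i,
    (Real.exp (l / w i * Z i t ω) + Real.exp (-(l / w i) * Z i t ω)) with hG
  set W : Ω → ℝ := fun ω => ∑ i ∈ I, w i / M i * G i ω with hW
  have hGint : ∀ i ∈ I, Integrable (G i) μ := fun i hi =>
    integrable_finsetSum _ fun t ht => (hint i hi t ht _).add (hint i hi t ht _)
  have hWint : Integrable W μ := integrable_finsetSum _ fun i hi => (hGint i hi).const_mul _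
  have hG0 : ∀ i ω, 0 ≤ G i ω := fun i ω => Finset.sum_nonneg fun t _ => by positivity
  have hW0 : ∀ ω, 0 ≤ W ω := fun ω => Finset.sum_nonneg fun i hi =>
    mul_nonneg (div_nonneg (hw i hi).le (hM i hi).le) (hG0 i ω)
  have hGle : ∀ i ∈ I, ∫ ω, G i ω ∂μ ≤ M i := by
    intro i hi
    refine le_trans (le_of_eq ?_) (hbound i hi)
    have hs : ∀ t ∈ U i, Integrable (fun ω => Real.exp (l / w i * Z i t ω) +
        Real.exp (-(l / w i) * Z i t ω)) μ := fun t ht =>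
      (hint i hi t ht _).add (hint i hi t ht _)
    simp only [hG]
    rw [integral_finsetSum _ hs]
    exact Finset.sum_congr rfl fun t ht => integral_add (hint i hi t ht _) (hint i hi t ht _)
  have hWle : ∫ ω, W ω ∂μ ≤ 1 := by
    rw [integral_finsetSum _ fun i hi => (hGint i hi).const_mul _, ← hw1]
    refine Finset.sum_le_sum fun i hi => ?_
    rw [integral_const_mul, div_mul_eq_mul_div, div_le_iff₀ (hM i hi)]
    exact mul_le_mul_of_nonneg_left (hGle i hi) (hw i hi).le
  set C := Real.exp (∑ i ∈ I, w i * Real.log (M i)) with hC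
  have hsub : E ⊆ {ω | Real.exp (l * x) / C ≤ W ω} := by
    intro ω hω
    obtain ⟨z, hz, hx⟩ := hE ω hω
    -- The w_i cancel in the exponent, which is thus exhibited as a convex combination; Jensen for
    -- exp then bounds it by W.
    have h1 : Real.exp (l * x) / C ≤
        Real.exp (∑ i ∈ I, w i • (l / w i * |Z i (z i) ω| - Real.log (M i))) := by
      rw [hC, ← Real.exp_sub]
      apply Real.exp_le_exp.2
      have : ∑ i ∈ I, w i • (l / w i * |Z i (z i) ω| - Real.log (M i)) =
          l * ∑ i ∈ I, |Z i (z i) ω| - ∑ i ∈ I, w i * Real.log (M i) := by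
        rw [Finset.mul_sum, ← Finset.sum_sub_distrib]
        refine Finset.sum_congr rfl fun i hi => ?_
        have := (hw i hi).ne'
        simp only [smul_eq_mul]
        field_simp
      rw [this]
      linarith [mul_le_mul_of_nonneg_left hx hl]
    refine h1.trans ((convexOn_exp.map_sum_le (fun i hi => (hw i hi).le) hw1
      fun _ _ => mem_univ _).trans ?_)
    refine Finset.sum_le_sum fun i hi => ?_
    rw [smul_eq_mul, Real.exp_sub, Real.exp_log (hM i hi), mul_div_assoc', mul_div_right_comm]
    refine mul_le_mul_of_nonneg_left ?_ (div_nonneg (hw i hi).le (hM i hi).le)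
    refine le_trans ?_ (Finset.single_le_sum (f := fun t => Real.exp (l / w i * Z i t ω) +
      Real.exp (-(l / w i) * Z i t ω)) (fun t _ => by positivity) (hz i hi))
    rcases abs_choice (Z i (z i) ω) with h | h <;> rw [h]
    · linarith [Real.exp_pos (-(l / w i) * Z i (z i) ω)]
    · rw [mul_neg, ← neg_mul]
      linarith [Real.exp_pos (l / w i * Z i (z i) ω)]
  have hCpos : 0 < C := Real.exp_pos _
  have hmarkov := mul_meas_ge_le_integral_of_nonneg (ae_of_all _ hW0) hWint (Real.exp (l * x) / C)
  have h2 : Real.exp (l * x) / C * μ.real E ≤ 1 :=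
    (mul_le_mul_of_nonneg_left (measureReal_mono hsub) (by positivity)).trans (hmarkov.trans hWle)
  rw [Real.exp_neg]
  have hexp := Real.exp_pos (l * x)
  rw [div_mul_eq_mul_div, div_le_one hCpos] at h2
  rw [← div_eq_inv_mul, le_div_iff₀ hexp]
  linarith

/-- The chain runs backwards from z_n = t by z_k = β_k(z_{k+1}), so the terms Z_k(z_k) telescope to
x(t). The endpoint t is arbitrary and need not lie in a net. -/
lemma exists_chain {T : Type*} (x : T → ℝ) (U : ℕ → Finset T) (β : ℕ → T → T)
    (hβ : ∀ k t, β k t ∈ U k) (Z : ℕ → T → ℝ) (hZ0 : ∀ t, Z 0 t = x t)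
    (hZ : ∀ k t, Z (k + 1) t = x t - x (β k t)) (n : ℕ) (t : T) :
    ∃ z : ℕ → T, (∀ k < n, z k ∈ U k) ∧ z n = t ∧
      |x t| ≤ ∑ k ∈ Finset.range (n + 1), |Z k (z k)| := by
  induction n generalizing t with
  | zero => exact ⟨fun _ => t, by simp, rfl, by simp [hZ0]⟩
  | succ n ih =>
    obtain ⟨z, hz, hzn, hzx⟩ := ih (β n t)
    refine ⟨Function.update z (n + 1) t, fun k hk => ?_, by simp, ?_⟩
    · rw [Function.update_of_ne (by omega)]
      rcases Nat.lt_succ_iff_lt_or_eq.1 hk with h | rfl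
      · exact hz k h
      · rw [hzn]; exact hβ k t
    · rw [Finset.sum_range_succ, Function.update_self, hZ]
      have hs : ∑ k ∈ Finset.range (n + 1),
          |Z k (Function.update z (n + 1) t k)| = ∑ k ∈ Finset.range (n + 1), |Z k (z k)| := by
        refine Finset.sum_congr rfl fun k hk => ?_
        rw [Function.update_of_ne (by have := Finset.mem_range.1 hk; omega)]
      rw [hs]
      have := abs_add_le (x t - x (β n t)) (x (β n t))
      rw [sub_add_cancel] at this
      linarith

/-! ### The entropy function and its integral -/

section EntropyFunction

variable {r : ℝ → ℝ}

/-- Convexity makes f = r ∘ exp continuous on (0, ∞). The line through (0, f 0) and (1, f 1) lies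
above f on [0, 1] and below it afterwards, which rules out a jump at 0 and forces f to be unbounded.
-/
lemma exists_eq_of_convexOn_comp_exp (hr_mono : StrictMonoOn r (Ici 1))
    (hr_convex : ConvexOn ℝ (Ici 0) (fun x => r (Real.exp x))) {y : ℝ} (hy : r 1 ≤ y) :
    ∃ x ∈ Ici (1 : ℝ), r x = y := by
  rcases hy.eq_or_lt with rfl | hy
  · exact ⟨1, self_mem_Ici, rfl⟩
  set f : ℝ → ℝ := fun x => r (Real.exp x) with hf
  have hf0 : f 0 = r 1 := by simp [hf]
  have hd : f 0 < f 1 := hr_mono (by simp) (by simp) (by simp)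
  have hlow : ∀ s, 0 ≤ s → s ≤ 1 → f s ≤ f 0 + s * (f 1 - f 0) := by
    intro s h0 h1
    have := hr_convex.2 (show (0 : ℝ) ∈ Ici 0 by simp) (show (1 : ℝ) ∈ Ici 0 by simp)
      (sub_nonneg.2 h1) h0 (by ring)
    simp only [smul_eq_mul, mul_zero, mul_one, zero_add] at this
    change f s ≤ (1 - s) * f 0 + s * f 1 at this
    linarith
  have hhigh : ∀ s, 1 ≤ s → f 0 + s * (f 1 - f 0) ≤ f s := by
    intro s h1
    have hs : 0 < s := by linarith
    have := hr_convex.2 (show (0 : ℝ) ∈ Ici 0 by simp) (show s ∈ Ici (0 : ℝ) from hs.le)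
      (show 0 ≤ 1 - s⁻¹ from sub_nonneg.2 (inv_le_one_of_one_le₀ h1)) (inv_nonneg.2 hs.le) (by ring)
    simp only [smul_eq_mul, mul_zero, inv_mul_cancel₀ hs.ne', zero_add] at this
    change f 1 ≤ (1 - s⁻¹) * f 0 + s⁻¹ * f s at this
    have h2 := mul_le_mul_of_nonneg_left this hs.le
    have h3 : s * ((1 - s⁻¹) * f 0 + s⁻¹ * f s) = s * f 0 - f 0 + f s := by
      field_simp
    rw [h3] at h2
    linarith
  -- The point where that line has height y; hence f(min q 1) ≤ y ≤ f(max q 1).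
  set q := (y - f 0) / (f 1 - f 0) with hq
  have hqpos : 0 < q := div_pos (by rw [hf0]; linarith) (by linarith)
  have hqy : q * (f 1 - f 0) = y - f 0 := div_mul_cancel₀ _ (by linarith)
  have hcont : ContinuousOn f (Icc (min q 1) (max q 1)) := by
    have := hr_convex.continuousOn_interior
    rw [interior_Ici] at this
    exact this.mono fun x hx => lt_of_lt_of_le (lt_min hqpos one_pos) hx.1
  have hmem : y ∈ Icc (f (min q 1)) (f (max q 1)) := by
    constructor
    · refine (hlow _ (le_min hqpos.le zero_le_one) (min_le_right _ _)).trans ?_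
      nlinarith [min_le_left q 1]
    · refine le_trans ?_ (hhigh _ (le_max_right _ _))
      nlinarith [le_max_left q 1]
  obtain ⟨x, hx, hxy⟩ := intermediate_value_Icc (min_le_max) hcont hmem
  exact ⟨Real.exp x, Real.one_le_exp ((le_min hqpos.le zero_le_one).trans hx.1), hxy⟩

/-- A weighted geometric mean is bounded by `r⁻¹` of any upper bound of the weighted mean of `r`. -/
lemma sum_mul_log_le_log_invFunOn (hr_mono : StrictMonoOn r (Ici 1))
    (hr_convex : ConvexOn ℝ (Ici 0) (fun x => r (Real.exp x))) {y : ℝ}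
    {ι : Type*} (I : Finset ι) (w N : ι → ℝ) (hw : ∀ i ∈ I, 0 ≤ w i) (hw1 : ∑ i ∈ I, w i = 1)
    (hN : ∀ i ∈ I, 1 ≤ N i) (hy : ∑ i ∈ I, w i * r (N i) ≤ y) :
    1 ≤ Function.invFunOn r (Ici 1) y ∧
      ∑ i ∈ I, w i * Real.log (N i) ≤ Real.log (Function.invFunOn r (Ici 1) y) := by
  have hy1 : r 1 ≤ y := by
    calc r 1 = ∑ i ∈ I, w i * r 1 := by rw [← Finset.sum_mul, hw1, one_mul]
      _ ≤ ∑ i ∈ I, w i * r (N i) := Finset.sum_le_sum fun i hi =>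
          mul_le_mul_of_nonneg_left (hr_mono.monotoneOn self_mem_Ici (hN i hi) (hN i hi)) (hw i hi)
      _ ≤ y := hy
  have hex := exists_eq_of_convexOn_comp_exp hr_mono hr_convex hy1
  have hR1 : 1 ≤ Function.invFunOn r (Ici 1) y := Function.invFunOn_mem hex
  have hRy : r (Function.invFunOn r (Ici 1) y) = y := Function.invFunOn_eq hex
  refine ⟨hR1, ?_⟩
  -- Jensen at the points log N_i turns the geometric mean of the N_i into the arithmetic mean of
  -- the r(N_i).
  have hjensen := hr_convex.map_sum_le hw hw1 (p := fun i => Real.log (N i))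
    fun i hi => Real.log_nonneg (hN i hi)
  simp only [smul_eq_mul] at hjensen
  have h0 : 0 ≤ ∑ i ∈ I, w i * Real.log (N i) :=
    Finset.sum_nonneg fun i hi => mul_nonneg (hw i hi) (Real.log_nonneg (hN i hi))
  have hsum : ∑ i ∈ I, w i * r (Real.exp (Real.log (N i))) = ∑ i ∈ I, w i * r (N i) :=
    Finset.sum_congr rfl fun i hi => by rw [Real.exp_log (by linarith [hN i hi])]
  rw [hsum] at hjensen
  rw [Real.le_log_iff_exp_le (by linarith)]
  refine (hr_mono.le_iff_le (Real.one_le_exp h0) hR1).1 ?_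
  rw [hRy]
  exact hjensen.trans hy

end EntropyFunction

/-- The cell (θ^(k+1) δ, θ^k δ] has length (1 - θ)θ^k δ and G ≥ N_k there; the remaining interval
(0, θ^n δ] contributes at least θ^n δ c. -/
lemma sum_geometric_mul_le_integral {G : ℝ → ℝ} {δ θ c : ℝ} {N : ℕ → ℝ} (hδ : 0 < δ)
    (hθ : 0 < θ) (hθ1 : θ < 1) (hG : IntegrableOn G (Ioc 0 δ))
    (hN : ∀ k, ∀ v ∈ Ioc 0 (θ ^ k * δ), N k ≤ G v) (hc : ∀ v ∈ Ioc 0 δ, c ≤ G v) (n : ℕ) :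
    ∑ k ∈ Finset.range n, (1 - θ) * θ ^ k * N k + θ ^ n * c ≤ (∫ v in Ioc 0 δ, G v) / δ := by
  have hpow : ∀ k : ℕ, θ ^ k * δ ≤ δ := fun k =>
    mul_le_of_le_one_left hδ.le (pow_le_one₀ hθ.le hθ1.le)
  have hpos : ∀ k : ℕ, 0 < θ ^ k * δ := fun k => by positivity
  have hstep : ∀ n : ℕ, δ * ∑ k ∈ Finset.range n, (1 - θ) * θ ^ k * N k +
      ∫ v in Ioc 0 (θ ^ n * δ), G v ≤ ∫ v in Ioc 0 δ, G v := by
    intro n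
    induction n with
    | zero => simp
    | succ n ih =>
      have hle : θ ^ (n + 1) * δ ≤ θ ^ n * δ := by
        rw [pow_succ]; nlinarith [hpos n]
      have hsplit : Ioc 0 (θ ^ n * δ) = Ioc 0 (θ ^ (n + 1) * δ) ∪
          Ioc (θ ^ (n + 1) * δ) (θ ^ n * δ) := (Ioc_union_Ioc_eq_Ioc (hpos _).le hle).symm
      have hi1 : IntegrableOn G (Ioc 0 (θ ^ (n + 1) * δ)) :=
        hG.mono_set (Ioc_subset_Ioc_right (hpow _))
      have hi2 : IntegrableOn G (Ioc (θ ^ (n + 1) * δ) (θ ^ n * δ)) :=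
        hG.mono_set (Ioc_subset_Ioc (hpos _).le (hpow _))
      rw [hsplit, setIntegral_union (Ioc_disjoint_Ioc_of_le le_rfl) measurableSet_Ioc hi1 hi2] at ih
      have hlow := setIntegral_mono_on (f := fun _ => N n)
        (integrableOn_const (by simp)) hi2 measurableSet_Ioc
        fun v hv => hN n v ⟨(hpos _).trans hv.1, hv.2⟩
      rw [setIntegral_const, Real.volume_real_Ioc_of_le hle, smul_eq_mul] at hlow
      rw [Finset.sum_range_succ, mul_add]
      have : δ * ((1 - θ) * θ ^ n * N n) = (θ ^ n * δ - θ ^ (n + 1) * δ) * N n := by ring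
      linarith
  have hlast := setIntegral_mono_on (f := fun _ => c) (g := G) (s := Ioc 0 (θ ^ n * δ))
    (μ := volume) (integrableOn_const (by simp)) (hG.mono_set (Ioc_subset_Ioc_right (hpow n)))
    measurableSet_Ioc fun v hv => hc v ⟨hv.1, hv.2.trans (hpow n)⟩
  rw [setIntegral_const, Real.volume_real_Ioc_of_le (hpos n).le, smul_eq_mul] at hlast
  rw [le_div_iff₀ hδ]
  have := hstep n
  linarith

/-! ### Chaining over a finite parameter set -/

/-- Geometric weights `(1 - θ) θ ^ k`, `k < n`, completed to total mass one by `θ ^ n`. -/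
def chainWeight (θ : ℝ) (n k : ℕ) : ℝ := if k < n then (1 - θ) * θ ^ k else θ ^ n

lemma chainWeight_pos {θ : ℝ} (hθ : 0 < θ) (hθ1 : θ < 1) (n k : ℕ) : 0 < chainWeight θ n k := by
  have : 0 < 1 - θ := by linarith
  unfold chainWeight
  split_ifs <;> positivity

lemma sum_chainWeight_mul (θ : ℝ) (n : ℕ) (g : ℕ → ℝ) :
    ∑ k ∈ Finset.range (n + 1), chainWeight θ n k * g k =
      ∑ k ∈ Finset.range n, (1 - θ) * θ ^ k * g k + θ ^ n * g n := by
  rw [Finset.sum_range_succ]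
  congr 1
  · exact Finset.sum_congr rfl fun k hk => by simp [chainWeight, Finset.mem_range.1 hk]
  · simp [chainWeight]

lemma sum_chainWeight (θ : ℝ) (n : ℕ) : ∑ k ∈ Finset.range (n + 1), chainWeight θ n k = 1 := by
  have := sum_chainWeight_mul θ n fun _ => 1
  simp only [mul_one] at this
  rw [this, ← Finset.mul_sum, mul_neg_geom_sum]
  ring

/-- Exponential tail bound for a process over a finite set of parameters, obtained by chaining
through finite `θ ^ (k + 1) * ε₀`-nets. -/
lemma measureReal_exists_le_of_chain {Ω T : Type*} [MeasurableSpace Ω] {μ : Measure Ω}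
    [IsProbabilityMeasure μ] {φ : ℝ → ℝ} (hφ : IsOrliczNFunction φ) {X : T → Ω → ℝ}
    (hX : ∀ t, IsPhiSubGaussian μ φ (X t)) {ε₀ θ : ℝ} (hε₀_pos : 0 < ε₀)
    (hε₀ : ∀ t, phiStandard μ φ (X t) ≤ ε₀) (hθ : 0 < θ) (hθ1 : θ < 1)
    (U : ℕ → Finset T)
    (hU : ∀ k t, ∃ s ∈ U k, phiStandard μ φ (fun ω => X t ω - X s ω) ≤ θ ^ (k + 1) * ε₀)
    (F : Finset T) (hF : F.Nonempty) (n : ℕ) {l : ℝ} (hl : 0 ≤ l) (x : ℝ) :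
    μ.real {ω | ∃ t ∈ F, x ≤ |X t ω|} ≤
      Real.exp (-(l * x)) * Real.exp (Real.log 2 + φ (l * ε₀ / (1 - θ)) +
        ∑ k ∈ Finset.range n, (1 - θ) * θ ^ k * Real.log (U k).card +
          θ ^ n * Real.log F.card) := by
  classical
  choose β hβU hβ using hU
  set Z : ℕ → T → Ω → ℝ := fun k => match k with
    | 0 => X
    | k + 1 => fun t ω => X t ω - X (β k t) ω with hZ
  have hZsub : ∀ k t, IsPhiSubGaussian μ φ (Z k t) := by
    rintro (_ | k) t
    · exact hX t
    · exact (hX t).sub hφ (hX _)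
  have hZτ : ∀ k t, phiStandard μ φ (Z k t) ≤ θ ^ k * ε₀ := by
    rintro (_ | k) t
    · simpa [hZ] using hε₀ t
    · exact hβ k t
  have hUne : ∀ k, (U k).Nonempty := fun k => ⟨_, hβU k hF.choose⟩
  -- The last level is F itself, so chains end exactly at the points of F.
  set V : ℕ → Finset T := fun k => if k < n then U k else F with hV
  set w : ℕ → ℝ := chainWeight θ n with hw
  set Φ := φ (l * ε₀ / (1 - θ)) with hΦ
  have hθ' : 0 < 1 - θ := by linarith
  have hwpos : ∀ k, 0 < w k := chainWeight_pos hθ hθ1 n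
  have hw1 : ∑ k ∈ Finset.range (n + 1), w k = 1 := sum_chainWeight θ n
  have hVcard : ∀ k, 0 < ((V k).card : ℝ) := by
    intro k
    simp only [hV]
    split_ifs
    · exact_mod_cast (hUne k).card_pos
    · exact_mod_cast hF.card_pos
  -- For k < n the factors θ^k cancel and the argument of φ is exactly lε₀/(1 - θ); for k = n it is
  -- the smaller lε₀.
  have hterm : ∀ k ∈ Finset.range (n + 1), ∀ t, ∀ c : ℝ, |c| = l / w k →
      ∫ ω, Real.exp (c * Z k t ω) ∂μ ≤ Real.exp Φ := by
    intro k hk t c hc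
    refine ((hZsub k t).integral_exp_le hφ (hZτ k t) c).trans
      (Real.exp_le_exp.2 (hφ.le_of_abs_le ?_))
    have hεk : 0 < θ ^ k * ε₀ := by positivity
    have hrhs : 0 ≤ l * ε₀ / (1 - θ) := by positivity
    rw [abs_mul, hc, abs_of_pos hεk, abs_of_nonneg hrhs]
    rcases Nat.lt_succ_iff_lt_or_eq.1 (Finset.mem_range.1 hk) with h | rfl
    · simp only [hw, chainWeight, if_pos h]
      apply le_of_eq
      field_simp
    · simp only [hw, chainWeight, lt_irrefl, if_false]
      have h1 : θ ^ k * ε₀ * (l / θ ^ k) = l * ε₀ := by field_simp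
      rw [h1, le_div_iff₀ hθ']
      nlinarith [mul_nonneg hl hε₀_pos.le]
  have key := measureReal_le_exp_of_chain (μ := μ) (Finset.range (n + 1)) w
    (fun k => 2 * Real.exp Φ * (V k).card) (fun k _ => hwpos k) hw1
    (fun k _ => by have := hVcard k; positivity) V Z l x hl
    (fun k _ t _ c => (hZsub k t).integrable_exp c)
    (by
      intro k hk
      have habs : |l / w k| = l / w k := abs_of_nonneg (div_nonneg hl (hwpos k).le)
      refine (Finset.sum_le_card_nsmul _ _ (2 * Real.exp Φ) fun t _ => ?_).trans (le_of_eq ?_)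
      · have h1 := hterm k hk t (l / w k) habs
        have h2 := hterm k hk t (-(l / w k)) (by rw [abs_neg, habs])
        linarith
      · rw [nsmul_eq_mul, mul_comm])
    {ω | ∃ t ∈ F, x ≤ |X t ω|}
    (by
      rintro ω ⟨t, htF, ht⟩
      obtain ⟨z, hz, hzn, hzx⟩ := exists_chain (fun t => X t ω) U β hβU (fun k t => Z k t ω)
        (fun _ => rfl) (fun _ _ => rfl) n t
      refine ⟨z, fun k hk => ?_, ht.trans hzx⟩
      rcases Nat.lt_succ_iff_lt_or_eq.1 (Finset.mem_range.1 hk) with h | rfl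
      · simpa [hV, h] using hz k h
      · simpa [hV, hzn] using htF)
  refine key.trans (le_of_eq ?_)
  congr 2
  have hlog : ∀ k, Real.log (2 * Real.exp Φ * (V k).card) =
      Real.log 2 + Φ + Real.log (V k).card := by
    intro k
    rw [Real.log_mul (by positivity) (hVcard k).ne', Real.log_mul two_ne_zero
      (Real.exp_pos _).ne', Real.log_exp]
  simp only [hlog, mul_add (w _) (Real.log 2 + Φ), Finset.sum_add_distrib]
  rw [← Finset.sum_mul, hw1, one_mul, sum_chainWeight_mul, ← add_assoc]
  congr 2
  · exact Finset.sum_congr rfl fun k hk => by simp [hV, Finset.mem_range.1 hk]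
  · simp [hV]

/-! ### Separability -/

/-- Passage from finite subsets to the whole parameter set of a separable process. -/
lemma IsSeparableProcess.measureReal_le {Ω T : Type*} [MeasurableSpace Ω] {μ : Measure Ω}
    [IsProbabilityMeasure μ] {ρ : T → T → ℝ} {X : T → Ω → ℝ} (hsep : IsSeparableProcess μ ρ X)
    [Nonempty T] {u : ℝ} (B : ℝ → ℝ) (hB : ContinuousAt B u)
    (hfin : ∀ (F : Finset T), F.Nonempty → ∀ x, μ.real {ω | ∃ t ∈ F, x ≤ |X t ω|} ≤ B x) :
    μ.real {ω | (u : EReal) ≤ ⨆ t, ((|X t ω| : ℝ) : EReal)} ≤ B u := by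
  classical
  obtain ⟨S, hS, hae⟩ := hsep
  have hSne : S.Nonempty := by
    obtain ⟨ω, hω⟩ := hae.exists
    obtain ⟨s, hs, -⟩ := hω (Classical.arbitrary T) 1 one_pos
    exact ⟨s, hs⟩
  obtain ⟨f, rfl⟩ := hS.exists_eq_range hSne
  -- The supremum need not be attained, and passing to the countable set loses a little; a level x <
  -- u absorbs both, and continuity of B recovers u.
  have hlt : ∀ x < u, μ.real {ω | (u : EReal) ≤ ⨆ t, ((|X t ω| : ℝ) : EReal)} ≤ B x := by
    intro x hx
    set E : ℕ → Set Ω := fun m => {ω | ∃ t ∈ (Finset.range (m + 1)).image f, x ≤ |X t ω|} with hE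
    have hEmono : Monotone E := by
      intro m m' hmm ω hω
      obtain ⟨t, ht, hxt⟩ := hω
      exact ⟨t, Finset.image_subset_image (Finset.range_mono (by omega)) ht, hxt⟩
    have hEle : ∀ m, μ.real (E m) ≤ B x := fun m =>
      hfin _ ((Finset.nonempty_range_iff.2 (by omega)).image f) x
    have hsub : {ω | (u : EReal) ≤ ⨆ t, ((|X t ω| : ℝ) : EReal)} ≤ᵐ[μ] ⋃ m, E m := by
      filter_upwards [hae] with ω hω hu
      change (u : EReal) ≤ ⨆ t, ((|X t ω| : ℝ) : EReal) at hu
      obtain ⟨t, ht⟩ := lt_iSup_iff.1 (lt_of_lt_of_le (EReal.coe_lt_coe_iff.2 hx) hu)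
      have ht' : x < |X t ω| := EReal.coe_lt_coe_iff.1 ht
      obtain ⟨s, ⟨m, rfl⟩, -, hs⟩ := hω t (|X t ω| - x) (by linarith)
      refine mem_iUnion.2 ⟨m, f m, Finset.mem_image_of_mem _ (by simp), ?_⟩
      have := abs_sub_abs_le_abs_sub (X t ω) (X (f m) ω)
      linarith
    have h1 : μ.real {ω | (u : EReal) ≤ ⨆ t, ((|X t ω| : ℝ) : EReal)} ≤ μ.real (⋃ m, E m) :=
      ENNReal.toReal_mono (measure_ne_top _ _) (measure_mono_ae hsub)
    refine h1.trans ?_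
    have h2 := (ENNReal.tendsto_toReal (measure_ne_top μ (⋃ m, E m))).comp
      (tendsto_measure_iUnion_atTop hEmono)
    exact le_of_tendsto h2 (Eventually.of_forall hEle)
  exact ge_of_tendsto (hB.tendsto.mono_left (nhdsWithin_le_nhds (s := Iio u)))
    (eventually_nhdsWithin_of_forall hlt)

/-! ### The inverse of σ and nets of the rectangle -/

section Inverse

variable {σ : ℝ → ℝ} {K : ℝ}

lemma pos_of_strictMonoOn_of_tendsto_zero (hσ_mono : StrictMonoOn σ (Ioc 0 K))
    (hσ_zero : Tendsto σ (𝓝[>] 0) (𝓝 0)) {h : ℝ} (hh : h ∈ Ioc 0 K) : 0 < σ h := by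
  have hh2 : h / 2 ∈ Ioc 0 K := ⟨by linarith [hh.1], by linarith [hh.1, hh.2]⟩
  refine lt_of_le_of_lt ?_ (hσ_mono hh2 hh (by linarith [hh.1]))
  refine le_of_tendsto hσ_zero ?_
  filter_upwards [Ioc_mem_nhdsGT hh2.1] with s hs
  exact hσ_mono.monotoneOn ⟨hs.1, hs.2.trans hh2.2⟩ hh2 hs.2

lemma exists_mem_Ioc_eq_of_tendsto_zero (hK : 0 < K) (hσ_cont : ContinuousOn σ (Ioc 0 K))
    (hσ_zero : Tendsto σ (𝓝[>] 0) (𝓝 0)) {v : ℝ}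
    (hv : v ∈ Ioc 0 (σ K)) : ∃ h ∈ Ioc 0 K, σ h = v := by
  obtain ⟨h', hh', hv'⟩ := (Eventually.and (Ioc_mem_nhdsGT hK)
    (hσ_zero.eventually_lt_const hv.1)).exists
  obtain ⟨h, hh, rfl⟩ := intermediate_value_Icc hh'.2
    (hσ_cont.mono fun x hx => ⟨hh'.1.trans_le hx.1, hx.2⟩) ⟨hv'.le, hv.2⟩
  exact ⟨h, ⟨hh'.1.trans_le hh.1, hh.2⟩, rfl⟩

end Inverse

/-- Finite nets of the rectangle whose cardinality is controlled by the entropy integrand. -/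
lemma exists_net_le_entropyIntegrand {Ω : Type*} [MeasurableSpace Ω] {μ : Measure Ω}
    {φ : ℝ → ℝ} {a₁ b₁ a₂ b₂ : ℝ} (h₁ : a₁ ≤ b₁) (h₂ : a₂ ≤ b₂)
    (hL : 0 < max (b₁ - a₁) (b₂ - a₂)) {X : Rect a₁ b₁ a₂ b₂ → Ω → ℝ} {σ r : ℝ → ℝ}
    (hσ_mono : StrictMonoOn σ (Ioc 0 (max (b₁ - a₁) (b₂ - a₂))))
    (hσ_cont : ContinuousOn σ (Ioc 0 (max (b₁ - a₁) (b₂ - a₂))))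
    (hσ_zero : Tendsto σ (𝓝[>] 0) (𝓝 0))
    (hσ : ∀ h ∈ Ioc 0 (max (b₁ - a₁) (b₂ - a₂)), ∀ t s : Rect a₁ b₁ a₂ b₂,
      dist t s ≤ h → phiStandard μ φ (fun ω => X t ω - X s ω) ≤ σ h)
    (hr_mono : StrictMonoOn r (Ici 1)) {v : ℝ}
    (hv : v ∈ Ioc 0 (σ (max (b₁ - a₁) (b₂ - a₂)))) :
    ∃ A : Finset (Rect a₁ b₁ a₂ b₂), A.Nonempty ∧
      (∀ t, ∃ s ∈ A, phiStandard μ φ (fun ω => X t ω - X s ω) ≤ v) ∧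
      ∀ v' ∈ Ioc 0 v, r A.card ≤ entropyIntegrand r σ a₁ b₁ a₂ b₂ v' := by
  set K := max (b₁ - a₁) (b₂ - a₂) with hK
  set g := Function.invFunOn σ (Ioc 0 K) with hg
  have hmem : ∀ v' ∈ Ioc 0 v, g v' ∈ Ioc 0 K ∧ σ (g v') = v' := fun v' hv' =>
    have hex := exists_mem_Ioc_eq_of_tendsto_zero hL hσ_cont hσ_zero
      ⟨hv'.1, hv'.2.trans hv.2⟩
    ⟨Function.invFunOn_mem hex, Function.invFunOn_eq hex⟩
  obtain ⟨hgv, hgv'⟩ := hmem v ⟨hv.1, le_rfl⟩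
  obtain ⟨A, hA, hAc, hAd⟩ := exists_finset_Rect_cover h₁ h₂ hgv.1
  refine ⟨A, hA, fun t => ?_, fun v' hv' => ?_⟩
  · obtain ⟨s, hs, hts⟩ := hAd t
    exact ⟨s, hs, (hσ _ hgv t s hts).trans hgv'.le⟩
  · obtain ⟨hg1, hg2⟩ := hmem v' hv'
    have hle : g v' ≤ g v := (hσ_mono.le_iff_le hg1 hgv).1 (by rw [hg2, hgv']; exact hv'.2)
    have hcard : (1 : ℝ) ≤ A.card := by exact_mod_cast hA.card_pos
    have hg0 := hg1.1
    have hgv0 := hgv.1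
    have hL1 : 0 ≤ b₁ - a₁ := by linarith
    have hL2 : 0 ≤ b₂ - a₂ := by linarith
    have hbound : (A.card : ℝ) ≤
        ((b₁ - a₁) / (2 * g v') + 1) * ((b₂ - a₂) / (2 * g v') + 1) :=
      hAc.trans (by gcongr)
    exact hr_mono.monotoneOn hcard (hcard.trans hbound) hbound

/-! ### The tail bound -/

theorem theorem1 {Ω : Type*} [MeasurableSpace Ω] (μ : Measure Ω) [IsProbabilityMeasure μ]
    (φ : ℝ → ℝ) (hφ : ConditionQ φ)
    (a₁ b₁ a₂ b₂ : ℝ) (h₁ : a₁ ≤ b₁) (h₂ : a₂ ≤ b₂) (hL : 0 < max (b₁ - a₁) (b₂ - a₂))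
    (X : Rect a₁ b₁ a₂ b₂ → Ω → ℝ)
    (hX : ∀ t, IsPhiSubGaussian μ φ (X t))
    (hsep : IsSeparableProcess μ (phiPseudometric μ φ X) X)
    (ε₀ : ℝ) (hε₀ : IsLUB (range fun t => phiStandard μ φ (X t)) ε₀) (hε₀_pos : 0 < ε₀)
    (σ : ℝ → ℝ)
    (hσ_mono : StrictMonoOn σ (Ioc 0 (max (b₁ - a₁) (b₂ - a₂))))
    (hσ_cont : ContinuousOn σ (Ioc 0 (max (b₁ - a₁) (b₂ - a₂))))
    (hσ_zero : Tendsto σ (𝓝[>] 0) (𝓝 0))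
    (hσ : ∀ h ∈ Ioc 0 (max (b₁ - a₁) (b₂ - a₂)), ∀ t s : Rect a₁ b₁ a₂ b₂,
      dist t s ≤ h → phiStandard μ φ (fun ω => X t ω - X s ω) ≤ σ h)
    (γ₀ : ℝ) (hγ₀ : γ₀ = σ (max (b₁ - a₁) (b₂ - a₂)))
    (r : ℝ → ℝ)
    (hr_nonneg : ∀ x, 1 ≤ x → 0 ≤ r x)
    (hr_mono : StrictMonoOn r (Ici 1))
    (hr_convex : ConvexOn ℝ (Ici 0) (fun x => r (Real.exp x)))
    (hint : ∀ ε, 0 < ε → ε ≤ γ₀ →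
      IntegrableOn (entropyIntegrand r σ a₁ b₁ a₂ b₂) (Ioc 0 ε)) :
    ∀ θ u : ℝ, 0 < θ → θ < 1 → 0 < u → (r 1 = 0 ∨ θ * ε₀ ≤ γ₀) →
      μ.real {ω | (u : EReal) ≤ ⨆ t, ((|X t ω| : ℝ) : EReal)} ≤
        2 * (Real.exp (-youngFenchel φ (u * (1 - θ) / ε₀)) *
          Function.invFunOn r (Ici 1)
            (entropyIntegral r σ a₁ b₁ a₂ b₂ (min (θ * ε₀) γ₀) / (θ * ε₀))) := by
  intro θ u hθ hθ1 hu hcase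
  set K := max (b₁ - a₁) (b₂ - a₂) with hK
  set δ := θ * ε₀ with hδ
  have hδpos : 0 < δ := mul_pos hθ hε₀_pos
  have hθ' : 0 < 1 - θ := by linarith
  have hKmem : K ∈ Ioc 0 K := ⟨hL, le_rfl⟩
  have hγpos : 0 < γ₀ := hγ₀ ▸ pos_of_strictMonoOn_of_tendsto_zero hσ_mono hσ_zero hKmem
  let t₀ : Rect a₁ b₁ a₂ b₂ := ⟨(a₁, a₂), left_mem_Icc.2 h₁, left_mem_Icc.2 h₂⟩
  have : Nonempty (Rect a₁ b₁ a₂ b₂) := ⟨t₀⟩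
  -- Extension by zero beyond γ₀ allows cells of all of (0, δ] even when δ > γ₀, and gives the
  -- integral up to min(δ, γ₀).
  set G : ℝ → ℝ := (Ioc 0 γ₀).indicator (entropyIntegrand r σ a₁ b₁ a₂ b₂) with hG
  have hGint : IntegrableOn G (Ioc 0 δ) :=
    ((integrable_indicator_iff measurableSet_Ioc).2 (hint γ₀ hγpos le_rfl)).integrableOn
  have hGI : ∫ v in Ioc 0 δ, G v = entropyIntegral r σ a₁ b₁ a₂ b₂ (min δ γ₀) := by
    rw [hG, setIntegral_indicator measurableSet_Ioc, Ioc_inter_Ioc, entropyIntegral, sup_idem]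
  have hsmall : ∀ v ∈ Ioc 0 γ₀, ∃ A : Finset (Rect a₁ b₁ a₂ b₂), A.Nonempty ∧
      (∀ t, ∃ s ∈ A, phiStandard μ φ (fun ω => X t ω - X s ω) ≤ v) ∧
      ∀ v' ∈ Ioc 0 v, r A.card ≤ G v' := by
    intro v hv
    obtain ⟨A, hA, hAd, hAr⟩ := exists_net_le_entropyIntegrand h₁ h₂ hL hσ_mono hσ_cont hσ_zero hσ
      hr_mono (hγ₀ ▸ hv)
    refine ⟨A, hA, hAd, fun v' hv' => ?_⟩
    rw [hG, indicator_of_mem (show v' ∈ Ioc 0 γ₀ from ⟨hv'.1, hv'.2.trans hv.2⟩)]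
    exact hAr v' hv'
  -- Beyond γ₀ the function G vanishes, so this needs either r(1) = 0 or δ ≤ γ₀.
  have hr1 : ∀ v ∈ Ioc 0 δ, r 1 ≤ G v := by
    intro v hv
    by_cases hvγ : v ≤ γ₀
    · obtain ⟨A, hA, -, hAr⟩ := hsmall v ⟨hv.1, hvγ⟩
      have hcard : (1 : ℝ) ≤ A.card := by exact_mod_cast hA.card_pos
      exact (hr_mono.monotoneOn self_mem_Ici hcard hcard).trans (hAr v ⟨hv.1, le_rfl⟩)
    · rw [hG, indicator_of_notMem fun h => hvγ h.2]
      rcases hcase with h | h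
      · exact h.le
      · exact absurd (hv.2.trans h) hvγ
  have hnet : ∀ k : ℕ, ∃ A : Finset (Rect a₁ b₁ a₂ b₂), A.Nonempty ∧
      (∀ t, ∃ s ∈ A, phiStandard μ φ (fun ω => X t ω - X s ω) ≤ θ ^ (k + 1) * ε₀) ∧
      ∀ v' ∈ Ioc 0 (θ ^ k * δ), r A.card ≤ G v' := by
    intro k
    have hk : θ ^ (k + 1) * ε₀ = θ ^ k * δ := by rw [hδ, pow_succ]; ring
    rw [hk]
    by_cases hkγ : θ ^ k * δ ≤ γ₀
    · exact hsmall _ ⟨by positivity, hkγ⟩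
    -- At radii above γ₀ = σ(K) a single point is a net, since the rectangle has max-metric diameter
    -- K.
    · refine ⟨{t₀}, Finset.singleton_nonempty _, fun t => ⟨t₀, Finset.mem_singleton_self _, ?_⟩,
        fun v' hv' => ?_⟩
      · refine (hσ K hKmem t t₀ ?_).trans (hγ₀ ▸ (not_le.1 hkγ).le)
        have hx := t.2.1
        have hy := t.2.2
        refine max_le_max ?_ ?_
        · change |t.1.1 - a₁| ≤ _
          rw [abs_of_nonneg (by linarith [hx.1])]
          linarith [hx.2]
        · change |t.1.2 - a₂| ≤ _
          rw [abs_of_nonneg (by linarith [hy.1])]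
          linarith [hy.2]
      · simpa using hr1 v' ⟨hv'.1, hv'.2.trans
          (mul_le_of_le_one_left hδpos.le (pow_le_one₀ hθ.le hθ1.le))⟩
  choose U hUne hUd hUr using hnet
  set y := entropyIntegral r σ a₁ b₁ a₂ b₂ (min δ γ₀) / δ
  set R := Function.invFunOn r (Ici 1) y
  have hlogR : ∀ n : ℕ, 1 ≤ R ∧
      ∑ k ∈ Finset.range n, (1 - θ) * θ ^ k * Real.log (U k).card ≤ Real.log R := by
    intro n
    have hsum := sum_geometric_mul_le_integral hδpos hθ hθ1 hGint hUr hr1 n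
    rw [hGI] at hsum
    -- The leftover weight θ^n gets the value 1, whose logarithm is 0; the cardinality of F is dealt
    -- with separately, by letting n tend to infinity.
    set N : ℕ → ℝ := fun k => if k < n then ((U k).card : ℝ) else 1 with hN
    have hcomp : ∀ f : ℝ → ℝ, ∑ k ∈ Finset.range (n + 1), chainWeight θ n k * f (N k) =
        ∑ k ∈ Finset.range n, (1 - θ) * θ ^ k * f (U k).card + θ ^ n * f 1 := by
      intro f
      rw [sum_chainWeight_mul θ n fun k => f (N k)]
      congr 1
      · exact Finset.sum_congr rfl fun k hk => by simp [hN, Finset.mem_range.1 hk]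
      · simp [hN]
    have := sum_mul_log_le_log_invFunOn hr_mono hr_convex (y := y) (Finset.range (n + 1))
      (chainWeight θ n) N (fun k _ => (chainWeight_pos hθ hθ1 n k).le) (sum_chainWeight θ n)
      (fun k _ => by
        simp only [hN]
        split_ifs
        · exact_mod_cast (hUne k).card_pos
        · exact le_rfl)
      (by rw [hcomp]; exact hsum)
    rw [hcomp Real.log, Real.log_one, mul_zero, add_zero] at this
    exact this
  have hR1 : 1 ≤ R := (hlogR 0).1
  have hRpos : 0 < R := by linarith
  have htail : ∀ l : ℝ, 0 ≤ l → μ.real {ω | (u : EReal) ≤ ⨆ t, ((|X t ω| : ℝ) : EReal)} ≤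
      Real.exp (-(l * u)) * (2 * Real.exp (φ (l * ε₀ / (1 - θ))) * R) := by
    intro l hl
    refine hsep.measureReal_le
      (fun x => Real.exp (-(l * x)) * (2 * Real.exp (φ (l * ε₀ / (1 - θ))) * R))
      (by fun_prop) fun F hF x => ?_
    have hlim : Tendsto (fun n : ℕ => Real.exp (-(l * x)) * Real.exp (Real.log 2 +
        φ (l * ε₀ / (1 - θ)) + Real.log R + θ ^ n * Real.log F.card)) atTop
        (𝓝 (Real.exp (-(l * x)) * Real.exp (Real.log 2 +
        φ (l * ε₀ / (1 - θ)) + Real.log R + 0 * Real.log F.card))) :=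
      ((Real.continuous_exp.tendsto _).comp (tendsto_const_nhds.add
        ((tendsto_pow_atTop_nhds_zero_of_lt_one hθ.le hθ1).mul_const _))).const_mul _
    rw [zero_mul, add_zero, Real.exp_add, Real.exp_add, Real.exp_log two_pos,
      Real.exp_log hRpos] at hlim
    refine ge_of_tendsto hlim (Eventually.of_forall fun n => ?_)
    refine (measureReal_exists_le_of_chain hφ.toIsOrliczNFunction hX hε₀_pos
      (fun t => hε₀.1 (mem_range_self t)) hθ hθ1 U hUd F hF n hl x).trans ?_
    have := (hlogR n).2
    gcongr
  set P := μ.real {ω | (u : EReal) ≤ ⨆ t, ((|X t ω| : ℝ) : EReal)} with hP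
  rcases (measureReal_nonneg : 0 ≤ P).eq_or_lt with hP0 | hP0
  · exact hP0.ge.trans (by positivity)
  -- Each z in the supremum corresponds to l = |z|(1 - θ)/ε₀, which turns the argument of φ into
  -- |z|. Taking logarithms requires P > 0.
  have hstar : youngFenchel φ (u * (1 - θ) / ε₀) ≤ Real.log (2 * R / P) := by
    refine ciSup_le fun z => ?_
    have h := htail (|z| * (1 - θ) / ε₀) (by positivity)
    have h1 : |z| * (1 - θ) / ε₀ * ε₀ / (1 - θ) = |z| := by field_simp
    have h2 : |z| * (1 - θ) / ε₀ * u = u * (1 - θ) / ε₀ * |z| := by ring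
    have hφz : φ |z| ≤ φ z := hφ.le_of_abs_le (abs_abs z).le
    rw [h1, h2] at h
    rw [Real.le_log_iff_exp_le (by positivity), le_div_iff₀ hP0]
    have hz : u * (1 - θ) / ε₀ * z ≤ u * (1 - θ) / ε₀ * |z| := by
      gcongr
      exact le_abs_self z
    calc Real.exp (u * (1 - θ) / ε₀ * z - φ z) * P
        ≤ Real.exp (u * (1 - θ) / ε₀ * |z| - φ |z|) *
          (Real.exp (-(u * (1 - θ) / ε₀ * |z|)) * (2 * Real.exp (φ |z|) * R)) := by gcongr
      _ = Real.exp (u * (1 - θ) / ε₀ * |z| - φ |z| + -(u * (1 - θ) / ε₀ * |z|) + φ |z|) *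
          (2 * R) := by rw [Real.exp_add, Real.exp_add]; ring
      _ = 2 * R := by ring_nf; simp
  calc P = 2 * (Real.exp (-Real.log (2 * R / P)) * R) := by
        rw [Real.exp_neg, Real.exp_log (by positivity)]
        field_simp
    _ ≤ 2 * (Real.exp (-youngFenchel φ (u * (1 - θ) / ε₀)) * R) := by gcongr
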